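/- Let $p\in\mathbb N$ and consider the Ising model on $\underline\sigma\in\{-1,1\}^p$, $$\mu(\underline\sigma)\propto\exp\Big(\sum_{\{u,v\},\,u\ne v}\theta^*_{u,v}\sigma_u\sigma_v+\sum_u\theta^*_u\sigma_u\Big),$$ where the first sum is over unordered pairs and $\theta^*_{u,v}=\theta^*_{v,u}$. Assume $\sum_{v\ne u}|\theta^*_{u,v}|+|\theta^*_u|\le\gamma$ for all $u\in[p]$. Let $0<\epsilon\le4\gamma$ and $\delta>0$, and put $$d=\left\lceil\frac{3\gamma+\log\frac{16\gamma(1+\gamma)}{\epsilon^2}}{W\!\left(\frac3e+\frac{1}{\gamma e}\log\frac{16\gamma(1+\gamma)}{\epsilon^2}\right)}\right\rceil-1,\qquad T=\left\lceil\frac{576\,p\,\gamma^2e^{8\gamma}(1+\gamma)^2}{\epsilon^4}\right\rceil,\qquad \eta=\frac{2\gamma e^{-\gamma}}{3\sqrt{pT}},$$ $$n=\left\lceil 2^7e^{8\gamma}\gamma^2(1+\gamma)^2\,\frac{(d+2)\log(ep)+\log\frac{2p(d+2)}{\delta}}{\epsilon^4}\right\rceil,\qquad D=d+2-(d\bmod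 2),$$ where $W$ is the principal branch of the Lambert function. For every $K\subseteq[p]$ with $|K|\le D$ let $S_K=\frac1n\sum_{i=1}^n\prod_{j\in K}\sigma^{(K,i)}_j$ be the empirical moment computed from $n$ i.i.d. samples $\underline\sigma^{(K,1)},\dots,\underline\sigma^{(K,n)}$ of $\mu$. No assumption is made on the dependence between the samples used for different $K$ (the same samples may be used for all $K$). The algorithm has access to the data only through the numbers $S_K$, $|K|\le D$. For each $u\in[p]$ it works with vectors $x=(x_j)_{j\in[p]}$, where $x_u$ stands for the field $\theta_u$ and $x_v$, $v\ne u$, for $\theta_{u,v}$. The approximate gradient $g^u(x)\in\mathbb R^p$ at $x$ has components $$g^u_w(x)=-\sum_{k=0}^{d}\frac{(-1)^k}{k!}\sum_{m\in\mathbb N^p,\ \sum_j m_j=k}\frac{k!\prod_j x_j^{m_j}}{\prod_j m_j!}\;S_{K(u,w,k,m)},\qquad w\in[p],$$ where $K(u,w,k,m)$ is the set of sites whose exponent is odd in the monomial $\sigma_u^{k+1}\sigma_w\prod_{j\ne u}\sigma_j^{m_j}$ if $w\ne u$, and in $\sigma_u^{k+1}\prod_{j\ne u}\sigma_j^{m_j}$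 if $w=u$ (always $|K(u,w,k,m)|\le D$). This is the gradient of the interaction screening loss $\mathbb E\,e^{-\sigma_u(\theta_u+\sum_{v\ne u}\theta_{u,v}\sigma_v)}$ with the exponential replaced by its degree-$d$ Taylor polynomial and moments replaced by empirical moments. The algorithm starts at $x^{(1)}=0$, iterates $x^{(t+1)}=\mathcal P\big(x^{(t)}-\eta\,g^u(x^{(t)})\big)$, where $\mathcal P$ is the Euclidean projection onto $\{x:\|x\|_1\le\gamma\}$, and outputs $\hat\theta_u=\frac1T\sum_{t=1}^Tx^{(t)}$; write $\hat\theta_{u,v}$ for its coordinate $v\neq u$. Then, with probability at least $1-\delta$, $$\max_{u\in[p],\,v\ne u}|\hat\theta_{u,v}-\theta^*_{u,v}|\le\epsilon .$$ Moreover, for every fixed $\epsilon>0$, $d=O(\gamma)$ as $\gamma\to\infty$. -/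

import Mathlib

open MeasureTheory ProbabilityTheory
open scoped BigOperators

namespace IsingScreening

noncomputable section

/-! ### The Ising model -/

/-- Spin configurations in `{-1, 1}^p`; a spin is a unit of `ℤ`, that is `1` or `-1`. -/
abbrev Config (p : ℕ) : Type := Fin p → ℤˣ

/-- Every set of spins (hence every set of configurations) is measurable. -/
instance : DiscreteMeasurableSpace ℤˣ where
  forall_measurableSet s := ⟨Units.val '' s, trivial, by ext x; simp [Units.val_inj]⟩

/-- The value `±1` of the spin at `u`, as a real number. -/
def spin {p : ℕ} (σ : Config p) (u : Fin p) : ℝ := (((σ u : ℤˣ) : ℤ) : ℝ)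

/-- Parameters of a pairwise Ising model on `p` spins: one coupling `θ_{uv} = θ_{vu}` for each
unordered pair of distinct sites and one magnetic field `θ_u` for each site.  The diagonal
entries of `coupling` are never used. -/
structure Params (p : ℕ) where
  coupling : Fin p → Fin p → ℝ
  field : Fin p → ℝ
  symm : ∀ u v, coupling u v = coupling v u

/-- The energy `∑_{u ≠ v} θ_{uv} σ_u σ_v + ∑_u θ_u σ_u`, the first sum being over unordered pairs
(so that the conditional law of `σ_u` given the rest is proportional to
`exp (σ_u (θ_u + ∑_{v ≠ u} θ_{uv} σ_v))`). -/
def energy {p : ℕ} (θ : Params p) (σ : Config p) : ℝ :=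
  (∑ u, ∑ v ∈ Finset.Ioi u, θ.coupling u v * spin σ u * spin σ v) + ∑ u, θ.field u * spin σ u

/-- The probability of `σ` under the Gibbs distribution `μ(σ) ∝ exp (E(σ; θ))`. -/
def gibbsProb {p : ℕ} (θ : Params p) (σ : Config p) : ℝ :=
  Real.exp (energy θ σ) / ∑ τ, Real.exp (energy θ τ)

/-- The Gibbs distribution as a measure on configurations. -/
def gibbsMeasure {p : ℕ} (θ : Params p) : Measure (Config p) :=
  ∑ σ, ENNReal.ofReal (gibbsProb θ σ) • Measure.dirac σ

/-- `γ` bounds the `ℓ₁`-width of the model. -/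
def WidthLE {p : ℕ} (θ : Params p) (γ : ℝ) : Prop :=
  ∀ u, (∑ v ∈ Finset.univ.erase u, |θ.coupling u v|) + |θ.field u| ≤ γ

/-! ### Statistics -/

/-- Index set of the reduced statistics of order at most `D`. -/
abbrev StatIndex (p D : ℕ) : Type := {K : Finset (Fin p) // K.card ≤ D}

/-- The empirical average of `∏_{u ∈ K} σ_u` over `n` observations. -/
def empiricalMoment {p n : ℕ} (x : Fin n → Config p) (K : Finset (Fin p)) : ℝ :=
  (1 / (n : ℝ)) * ∑ i, ∏ u ∈ K, spin (x i) u

/-- The largest order `d + 2 - (d mod 2)` of the statistics used with Taylor degree `d`. -/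
def momentOrder (d : ℕ) : ℕ := d + 2 - d % 2

/-! ### The approximate gradient

The local parameter vector of node `u` is stored in `EuclideanSpace ℝ (Fin p)`: its coordinate `u`
is the magnetic field `θ_u`, its coordinate `v ≠ u` is the coupling `θ_{uv}`. -/

/-- Exponents of the monomial `σ_u^{k+1} σ_w ∏_{j ≠ u} σ_j^{m_j}`, where the factor `σ_w` is present
only if `w ≠ u` (it is absent in the partial derivative with respect to the field `θ_u`). -/
def monomialExponent {p : ℕ} (u w : Fin p) (k : ℕ) (m : Fin p → ℕ) (j : Fin p) : ℕ :=
  (if j = u then k + 1 else m j) + (if j = w ∧ w ≠ u then 1 else 0)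

/-- Since spins square to one, a monomial equals the product of the spins whose exponent is odd. -/
def reducedSet {p : ℕ} (u w : Fin p) (k : ℕ) (m : Fin p → ℕ) : Finset (Fin p) :=
  Finset.univ.filter fun j => Odd (monomialExponent u w k m j)

theorem card_reducedSet_le {p d k : ℕ} (hk : k < d + 1) (u w : Fin p) {m : Fin p → ℕ}
    (hm : m ∈ Finset.piAntidiag Finset.univ k) :
    (reducedSet u w k m).card ≤ momentOrder d := by
  classical
  have hsum : ∑ j, m j = k := (Finset.mem_piAntidiag.1 hm).1
  have hsupp : (Finset.univ.filter fun j => m j ≠ 0).card ≤ k := by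
    rw [← hsum, Finset.card_eq_sum_ones, Finset.sum_filter]
    exact Finset.sum_le_sum fun j _ => by split_ifs <;> omega
  have hsub : reducedSet u w k m ⊆
      (if Even k then {u} else ∅) ∪ ({w} ∪ Finset.univ.filter fun j => m j ≠ 0) := by
    intro j hj
    have hodd : Odd (monomialExponent u w k m j) := (Finset.mem_filter.1 hj).2
    by_cases hw : j = w
    · simp [hw]
    · by_cases hu : j = u
      · have hev : Even k := by
          have he : monomialExponent u w k m j = k + 1 := by
            simp [monomialExponent, hu, show ¬ (u = w ∧ w ≠ u) from fun h => h.2 h.1.symm]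
          rw [he] at hodd
          simpa [Nat.odd_add_one] using hodd
        simp [hev, hu]
      · have : m j ≠ 0 := by
          intro h0
          simp [monomialExponent, hu, hw, h0] at hodd
        simp [this]
  have hcard := (Finset.card_le_card hsub).trans (Finset.card_union_le _ _)
  have hcard' := Finset.card_union_le {w} (Finset.univ.filter fun j => m j ≠ 0)
  rw [Finset.card_singleton] at hcard'
  unfold momentOrder
  by_cases hev : Even k
  · rw [if_pos hev, Finset.card_singleton] at hcard
    obtain ⟨r, rfl⟩ := hev
    omega
  · rw [if_neg hev, Finset.card_empty] at hcard
    omega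

/-- The coefficient `C_{θ,m} = k! θ_u^{m_u} ∏_{j ≠ u} θ_{uj}^{m_j} / ∏_j m_j!`. -/
def multinomialCoeff {p : ℕ} (x : EuclideanSpace ℝ (Fin p)) (k : ℕ) (m : Fin p → ℕ) : ℝ :=
  (k.factorial : ℝ) * (∏ j, x j ^ m j) / ∏ j, ((m j).factorial : ℝ)

/-- The approximate gradient of the interaction screening loss of node `u` at `x`: in
`-𝔼[σ_u σ_w exp (-E_u)]` (for `w = u`: in `-𝔼[σ_u exp (-E_u)]`) the exponential is replaced by its
Taylor polynomial of degree `d`, the powers are expanded, and each monomial expectation is replaced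
by the corresponding statistic of order at most `d + 2 - (d mod 2)`. -/
def approxGrad {p d : ℕ} (S : StatIndex p (momentOrder d) → ℝ) (u : Fin p)
    (x : EuclideanSpace ℝ (Fin p)) : EuclideanSpace ℝ (Fin p) :=
  WithLp.toLp 2 fun w =>
    -∑ k : Fin (d + 1), ((-1 : ℝ) ^ (k : ℕ) / ((k : ℕ).factorial : ℝ)) *
      ∑ m ∈ (Finset.piAntidiag (Finset.univ : Finset (Fin p)) (k : ℕ)).attach,
        multinomialCoeff x k m.1 * S ⟨reducedSet u w k m.1, card_reducedSet_le k.2 u w m.2⟩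

/-! ### Projected gradient descent -/

/-- The `ℓ₁`-ball of radius `γ`. -/
def l1Ball (p : ℕ) (γ : ℝ) : Set (EuclideanSpace ℝ (Fin p)) := {x | ∑ j, |x j| ≤ γ}

theorem exists_l1Proj {p : ℕ} {γ : ℝ} (hγ : 0 ≤ γ) (x : EuclideanSpace ℝ (Fin p)) :
    ∃ y, y ∈ l1Ball p γ ∧ ∀ z ∈ l1Ball p γ, dist x y ≤ dist x z := by
  have hc : IsClosed (l1Ball p γ) :=
    isClosed_le (by fun_prop) continuous_const
  have hne : (l1Ball p γ).Nonempty := ⟨0, by simpa [l1Ball] using hγ⟩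
  obtain ⟨y, hy, hxy⟩ := hc.exists_infDist_eq_dist hne x
  exact ⟨y, hy, fun z hz => hxy ▸ Metric.infDist_le_dist_of_mem hz⟩

/-- The Euclidean projection onto the `ℓ₁`-ball of radius `γ`: the nearest point of the ball
(meaningful for `γ ≥ 0`). -/
def l1Proj {p : ℕ} (γ : ℝ) (x : EuclideanSpace ℝ (Fin p)) : EuclideanSpace ℝ (Fin p) :=
  Classical.epsilon fun y => y ∈ l1Ball p γ ∧ ∀ z ∈ l1Ball p γ, dist x y ≤ dist x z

theorem l1Proj_spec {p : ℕ} {γ : ℝ} (hγ : 0 ≤ γ) (x : EuclideanSpace ℝ (Fin p)) :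
    l1Proj γ x ∈ l1Ball p γ ∧ ∀ z ∈ l1Ball p γ, dist x (l1Proj γ x) ≤ dist x z :=
  Classical.epsilon_spec (exists_l1Proj hγ x)

/-- The iterates of projected gradient descent at node `u` with step size `η`, started at `0`;
`iterate S γ η u t` is the iterate number `t + 1`. -/
def iterate {p d : ℕ} (S : StatIndex p (momentOrder d) → ℝ) (γ η : ℝ) (u : Fin p) :
    ℕ → EuclideanSpace ℝ (Fin p)
  | 0 => 0
  | t + 1 => l1Proj γ (iterate S γ η u t - η • approxGrad S u (iterate S γ η u t))

/-- The output at node `u` of interaction screening with moment-based approximate gradients: the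
average of the first `T` iterates.  Coordinate `v ≠ u` is the estimate of `θ_{uv}`. -/
def estimate {p : ℕ} (d : ℕ) (S : StatIndex p (momentOrder d) → ℝ) (γ η : ℝ) (T : ℕ)
    (u : Fin p) : EuclideanSpace ℝ (Fin p) :=
  (1 / (T : ℝ)) • ∑ t ∈ Finset.range T, iterate S γ η u t

/-! ### Choice of the parameters -/

/-- The principal real branch of the Lambert `W` function: the inverse of `w ↦ w e^w` on
`[-1, ∞)` (meaningful for arguments at least `-1/e`). -/
def lambertW (z : ℝ) : ℝ := Function.invFunOn (fun w : ℝ => w * Real.exp w) (Set.Ici (-1)) z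

theorem lambertW_spec {z : ℝ} (hz : -Real.exp (-1) ≤ z) :
    -1 ≤ lambertW z ∧ lambertW z * Real.exp (lambertW z) = z := by
  have hex : ∃ w ∈ Set.Ici (-1 : ℝ), w * Real.exp w = z := by
    have hle : (-1 : ℝ) ≤ |z| := by linarith [abs_nonneg z]
    have hcont : ContinuousOn (fun w : ℝ => w * Real.exp w) (Set.Icc (-1) |z|) := by fun_prop
    have hup : z ≤ |z| * Real.exp |z| :=
      (le_abs_self z).trans
        (le_mul_of_one_le_right (abs_nonneg z) (Real.one_le_exp (abs_nonneg z)))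
    obtain ⟨w, hw, hwz⟩ := intermediate_value_Icc hle hcont ⟨by simpa using hz, hup⟩
    exact ⟨w, hw.1, hwz⟩
  exact ⟨Function.invFunOn_mem hex, Function.invFunOn_eq hex⟩

/-- The Taylor degree
`d = ⌈(3γ + log (16γ(1+γ)/ε²)) / W(3/e + log (16γ(1+γ)/ε²) / (γe))⌉ - 1`. -/
def taylorDegree (γ ε : ℝ) : ℕ :=
  ⌈(3 * γ + Real.log (16 * γ * (1 + γ) / ε ^ 2)) /
      lambertW (3 / Real.exp 1 +
        Real.log (16 * γ * (1 + γ) / ε ^ 2) / (γ * Real.exp 1))⌉₊ - 1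

/-- The number of iterations `T = ⌈576 p γ² e^{8γ} (1+γ)² / ε⁴⌉`. -/
def numSteps (p : ℕ) (γ ε : ℝ) : ℕ :=
  ⌈576 * (p : ℝ) * γ ^ 2 * Real.exp (8 * γ) * (1 + γ) ^ 2 / ε ^ 4⌉₊

/-- The step size `η = 2γ e^{-γ} / (3 √(pT))`. -/
def stepSize (p : ℕ) (γ ε : ℝ) : ℝ :=
  2 * γ * Real.exp (-γ) / (3 * Real.sqrt ((p : ℝ) * (numSteps p γ ε : ℝ)))

/-- The number of observations
`n = ⌈2⁷ e^{8γ} γ² (1+γ)² ((d+2) log (ep) + log (2p(d+2)/δ)) / ε⁴⌉`. -/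
def numSamples (p : ℕ) (γ ε δ : ℝ) : ℕ :=
  ⌈2 ^ 7 * Real.exp (8 * γ) * γ ^ 2 * (1 + γ) ^ 2 *
      ((((taylorDegree γ ε : ℝ) + 2) * Real.log (Real.exp 1 * (p : ℝ)) +
        Real.log (2 * (p : ℝ) * ((taylorDegree γ ε : ℝ) + 2) / δ)) / ε ^ 4)⌉₊

end

end IsingScreening

open IsingScreening

namespace IsingScreening

noncomputable section

/-! ### Spins and spin flips -/

/-! Fix a site u and let x* be its true local parameters. Flipping the spin at u multiplies the
Gibbs weight by exp(-2 margin(x*)) and changes the sign of every margin. Hence E[margin(y)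
exp(-margin(x*))] = 0 for every y: the screening gradient vanishes at x*
(`sum_gibbsProb_mul_margin_mul_exp`). Quantitatively, with z = margin(x - x*), the pairing of the
gradient at x with x - x* equals E[exp(-margin(x*)) z (1 - exp(-z))]. This is at least a multiple of
E[z^2], and E[z^2] dominates each (x_v - x*_v)^2, since z has conditional variance of that order
given all spins but the one at v. This gives `screening_strongly_monotone`, with constant
e^{-3γ}/(1+2γ).

The algorithm sees only an approximate gradient. On the ℓ₁-ball each coordinate is off by at most
e^γ times the moment error plus the Taylor remainder (`abs_approxGrad_sub_screeningGrad_le`). Paired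
with x - x*, of ℓ₁-norm at most 2γ, this costs 2γ times that bound. The regret inequality for
projected descent holds for any bounded vector field, so the approximate loss need not be convex.
Combined with monotonicity it bounds the average of (x_v - x*_v)^2 over the iterates, and
Cauchy–Schwarz passes to the averaged iterate (`abs_estimate_sub_le`).

The choice of d makes the Taylor remainder small through the equation W e^W = z
(`taylorDegree_spec`). Hoeffding's inequality and a union bound over the sets K make all moments
accurate at once, without any joint assumption across different K. -/

theorem spin_mul_self {p : ℕ} (σ : Config p) (u : Fin p) : spin σ u * spin σ u = 1 := by
  unfold spin
  rcases Int.units_eq_one_or (σ u) with h | h <;> simp [h]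

theorem abs_spin {p : ℕ} (σ : Config p) (u : Fin p) : |spin σ u| = 1 := by
  unfold spin
  rcases Int.units_eq_one_or (σ u) with h | h <;> simp [h]

theorem abs_prod_spin {p : ℕ} (σ : Config p) (K : Finset (Fin p)) :
    |∏ u ∈ K, spin σ u| = 1 := by
  rw [Finset.abs_prod]
  exact Finset.prod_eq_one fun u _ => abs_spin σ u

/-- The configuration `σ` with the spin at `u` reversed. -/
def flip {p : ℕ} (u : Fin p) (σ : Config p) : Config p := Function.update σ u (-σ u)

theorem flip_flip {p : ℕ} (u : Fin p) (σ : Config p) : flip u (flip u σ) = σ := by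
  simp [flip]

theorem spin_flip_self {p : ℕ} (u : Fin p) (σ : Config p) :
    spin (flip u σ) u = -spin σ u := by
  simp [spin, flip]

theorem spin_flip_of_ne {p : ℕ} {u v : Fin p} (h : v ≠ u) (σ : Config p) :
    spin (flip u σ) v = spin σ v := by
  simp [spin, flip, h]

theorem spin_flip {p : ℕ} (u v : Fin p) (σ : Config p) :
    spin (flip u σ) v = spin σ v + if v = u then -2 * spin σ u else 0 := by
  split_ifs with h
  · subst h; rw [spin_flip_self]; ring
  · rw [spin_flip_of_ne h, add_zero]

theorem sum_flip {p : ℕ} (u : Fin p) (f : Config p → ℝ) :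
    ∑ σ, f (flip u σ) = ∑ σ, f σ :=
  Equiv.sum_comp ⟨flip u, flip u, flip_flip u, flip_flip u⟩ f

/-- The variables `σ_u` (for `j = u`) and `σ_u σ_j` (for `j ≠ u`) multiplying the parameters in the
screening loss of `u`. -/
def screen {p : ℕ} (u : Fin p) (σ : Config p) (j : Fin p) : ℝ :=
  if j = u then spin σ u else spin σ u * spin σ j

/-- The part `σ_u (x_u + ∑_{j ≠ u} x_j σ_j)` of the energy that involves site `u`. -/
def margin {p : ℕ} (x : EuclideanSpace ℝ (Fin p)) (u : Fin p) (σ : Config p) : ℝ :=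
  ∑ j, x j * screen u σ j

/-- The parameters of the model that involve site `u`. -/
def localParam {p : ℕ} (θ : Params p) (u : Fin p) : EuclideanSpace ℝ (Fin p) :=
  WithLp.toLp 2 fun j => if j = u then θ.field u else θ.coupling u j

theorem abs_screen {p : ℕ} (u : Fin p) (σ : Config p) (j : Fin p) : |screen u σ j| = 1 := by
  unfold screen
  split_ifs <;> simp [abs_mul, abs_spin]

theorem abs_margin_le {p : ℕ} (x : EuclideanSpace ℝ (Fin p)) (u : Fin p) (σ : Config p) :
    |margin x u σ| ≤ ∑ j, |x j| := by
  unfold margin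
  refine (Finset.abs_sum_le_sum_abs _ _).trans (le_of_eq ?_)
  simp [abs_mul, abs_screen]

theorem screen_flip_self {p : ℕ} (u : Fin p) (σ : Config p) (j : Fin p) :
    screen u (flip u σ) j = -screen u σ j := by
  unfold screen
  split_ifs with h
  · exact spin_flip_self u σ
  · rw [spin_flip_self, spin_flip_of_ne h]; ring

theorem screen_flip_of_ne {p : ℕ} {u v : Fin p} (hvu : v ≠ u) (σ : Config p) (j : Fin p) :
    screen u (flip v σ) j = screen u σ j + if j = v then -2 * screen u σ v else 0 := by
  unfold screen
  by_cases h : j = u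
  · subst h
    simp [spin_flip_of_ne hvu.symm, hvu.symm]
  · by_cases hj : j = v
    · subst hj
      simp [spin_flip_of_ne hvu.symm, spin_flip_self, hvu]
      ring
    · simp [h, hj, spin_flip_of_ne hvu.symm, spin_flip_of_ne hj]

theorem margin_flip_self {p : ℕ} (x : EuclideanSpace ℝ (Fin p)) (u : Fin p) (σ : Config p) :
    margin x u (flip u σ) = -margin x u σ := by
  simp [margin, screen_flip_self]

theorem margin_flip_of_ne {p : ℕ} (x : EuclideanSpace ℝ (Fin p)) {u v : Fin p} (hvu : v ≠ u)
    (σ : Config p) :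
    margin x u (flip v σ) = margin x u σ - 2 * (x v * screen u σ v) := by
  simp only [margin, screen_flip_of_ne hvu, mul_add, Finset.sum_add_distrib, mul_ite, mul_zero,
    Finset.sum_ite_eq', Finset.mem_univ, if_true]
  ring

theorem margin_sub {p : ℕ} (x y : EuclideanSpace ℝ (Fin p)) (u : Fin p) (σ : Config p) :
    margin (x - y) u σ = margin x u σ - margin y u σ := by
  simp [margin, sub_mul, Finset.sum_sub_distrib]

/-! ### The energy and the Gibbs weights -/

/-- Half of a symmetric double sum with zero diagonal treats all sites alike, so the effect of a
flip does not depend on the position of the site in the order. -/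
theorem energy_eq {p : ℕ} (θ : Params p) (σ : Config p) :
    energy θ σ = 1 / 2 * (∑ a, ∑ b, (if a = b then 0 else θ.coupling a b) * spin σ a * spin σ b) +
      ∑ a, θ.field a * spin σ a := by
  unfold energy
  congr 1
  have h : ∀ a : Fin p, ∑ b, (if a = b then 0 else θ.coupling a b) * spin σ a * spin σ b =
      ∑ b ∈ Finset.Ioi a, θ.coupling a b * spin σ a * spin σ b +
      ∑ b ∈ Finset.Iio a, θ.coupling a b * spin σ a * spin σ b := by
    intro a
    simp only [← Finset.filter_lt_eq_Ioi, ← Finset.filter_gt_eq_Iio, Finset.sum_filter,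
      ← Finset.sum_add_distrib]
    refine Finset.sum_congr rfl fun b _ => ?_
    rcases lt_trichotomy a b with h | h | h
    · simp [h, h.ne, h.le]
    · simp [h]
    · simp [h, h.ne', h.le]
  have h2 : ∑ a, ∑ b ∈ Finset.Iio a, θ.coupling a b * spin σ a * spin σ b =
      ∑ a, ∑ b ∈ Finset.Ioi a, θ.coupling a b * spin σ a * spin σ b := by
    rw [Finset.sum_comm' (t' := Finset.univ) (s' := fun b => Finset.Ioi b) (by simp)]
    refine Finset.sum_congr rfl fun a _ => Finset.sum_congr rfl fun b _ => ?_
    rw [θ.symm]; ring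
  simp only [h, Finset.sum_add_distrib, h2]
  ring

theorem energy_flip {p : ℕ} (θ : Params p) (u : Fin p) (σ : Config p) :
    energy θ (flip u σ) = energy θ σ - 2 * margin (localParam θ u) u σ := by
  have hm : margin (localParam θ u) u σ = θ.field u * spin σ u +
      ∑ b, (if u = b then 0 else θ.coupling u b) * spin σ u * spin σ b := by
    unfold margin localParam screen
    rw [← Finset.add_sum_erase _ _ (Finset.mem_univ u),
      ← Finset.add_sum_erase _ (fun b => (if u = b then 0 else θ.coupling u b) * spin σ u * spin σ b)
        (Finset.mem_univ u)]
    simp only [if_true, zero_mul, zero_add]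
    congr 1
    refine Finset.sum_congr rfl fun b hb => ?_
    have hb' := Finset.ne_of_mem_erase hb
    simp [hb', hb'.symm, mul_assoc]
  -- The coupling matrix is made opaque so that `simp` later acts only on the conditionals produced
  -- by the flip.
  obtain ⟨A, hA⟩ : ∃ A : Fin p → Fin p → ℝ, ∀ a b, (if a = b then 0 else θ.coupling a b) = A a b :=
    ⟨_, fun _ _ => rfl⟩
  have hdiag : A u u = 0 := by simp [← hA]
  have hsymm : ∀ a, A a u * spin σ a * (-2 * spin σ u) = -2 * (A u a * spin σ u * spin σ a) := by
    intro a
    simp only [← hA, θ.symm a u, eq_comm (a := a)]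
    ring
  have hrow : ∑ a, ∑ b, (if a = u then A a b * (-2 * spin σ u) * spin σ b else 0) =
      -2 * ∑ b, A u b * spin σ u * spin σ b := by
    rw [Finset.sum_comm, Finset.mul_sum]
    refine Finset.sum_congr rfl fun b _ => ?_
    rw [Finset.sum_ite_eq' Finset.univ u, if_pos (Finset.mem_univ u)]
    ring
  rw [energy_eq, energy_eq, hm]
  simp only [hA, spin_flip, mul_add, add_mul, Finset.sum_add_distrib, mul_ite, ite_mul, mul_zero,
    zero_mul, Finset.sum_ite_eq', Finset.mem_univ, if_true, hdiag, hrow, hsymm]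
  rw [← Finset.mul_sum]
  ring

theorem gibbsProb_pos {p : ℕ} (θ : Params p) (σ : Config p) : 0 < gibbsProb θ σ := by
  unfold gibbsProb
  have : 0 < ∑ τ : Config p, Real.exp (energy θ τ) :=
    Finset.sum_pos (fun _ _ => Real.exp_pos _) Finset.univ_nonempty
  positivity

theorem sum_gibbsProb {p : ℕ} (θ : Params p) : ∑ σ, gibbsProb θ σ = 1 := by
  unfold gibbsProb
  have : 0 < ∑ τ : Config p, Real.exp (energy θ τ) :=
    Finset.sum_pos (fun _ _ => Real.exp_pos _) Finset.univ_nonempty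
  rw [← Finset.sum_div, div_self this.ne']

theorem gibbsProb_flip {p : ℕ} (θ : Params p) (u : Fin p) (σ : Config p) :
    gibbsProb θ (flip u σ) = gibbsProb θ σ * Real.exp (-2 * margin (localParam θ u) u σ) := by
  unfold gibbsProb
  rw [energy_flip, sub_eq_add_neg, Real.exp_add, div_mul_eq_mul_div, neg_mul]

theorem localParam_mem_l1Ball {p : ℕ} {θ : Params p} {γ : ℝ} (h : WidthLE θ γ) (u : Fin p) :
    localParam θ u ∈ l1Ball p γ := by
  refine le_trans (le_of_eq ?_) (h u)
  rw [← Finset.sum_erase_add _ _ (Finset.mem_univ u)]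
  congr 1
  · refine Finset.sum_congr rfl fun b hb => ?_
    simp [localParam, Finset.ne_of_mem_erase hb]
  · simp [localParam]

/-! ### Strong monotonicity of the gradient of the screening loss -/

/-- The weight times exp(-margin(x*)) is invariant under the flip at u, while `margin x u` is odd,
so the sum equals its own negative. -/
theorem sum_gibbsProb_mul_margin_mul_exp {p : ℕ} (θ : Params p) (u : Fin p)
    (x : EuclideanSpace ℝ (Fin p)) :
    ∑ σ, gibbsProb θ σ * (margin x u σ * Real.exp (-margin (localParam θ u) u σ)) = 0 := by
  have h := sum_flip u
    (fun σ => gibbsProb θ σ * (margin x u σ * Real.exp (-margin (localParam θ u) u σ)))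
  have h2 : ∀ σ, gibbsProb θ (flip u σ) * (margin x u (flip u σ) *
      Real.exp (-margin (localParam θ u) u (flip u σ))) =
      -(gibbsProb θ σ * (margin x u σ * Real.exp (-margin (localParam θ u) u σ))) := by
    intro σ
    rw [gibbsProb_flip, margin_flip_self, margin_flip_self]
    have : Real.exp (-margin (localParam θ u) u σ) =
        Real.exp (-2 * margin (localParam θ u) u σ) *
          Real.exp (- -margin (localParam θ u) u σ) := by
      rw [← Real.exp_add]; ring_nf
    rw [this]; ring
  simp only [h2, Finset.sum_neg_distrib] at h
  linarith

/-- With r = exp(-2h), 4r/(1+r)^2 = 1/cosh(h)^2 is the conditional variance of a spin in local field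
h, and cosh h ≤ e^γ. -/
theorem exp_add_exp_neg_sq_le {h γ : ℝ} (hh : |h| ≤ γ) :
    Real.exp (-2 * γ) * (1 + Real.exp (-2 * h)) ^ 2 ≤ 4 * Real.exp (-2 * h) := by
  obtain ⟨h1, h2⟩ := abs_le.1 hh
  have e1 : Real.exp (-γ - h) ≤ 1 := Real.exp_le_one_iff.2 (by linarith)
  have e2 : Real.exp (-γ + h) ≤ 1 := Real.exp_le_one_iff.2 (by linarith)
  have e3 : Real.exp (-2 * γ) * (1 + Real.exp (-2 * h)) ^ 2 =
      (Real.exp (-γ - h) + Real.exp (-γ + h)) ^ 2 * Real.exp (-2 * h) := by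
    have a1 : Real.exp (-2 * γ) = Real.exp (-γ) ^ 2 := by rw [← Real.exp_nat_mul]; norm_num
    have a2 : Real.exp (-2 * h) = Real.exp (-h) ^ 2 := by rw [← Real.exp_nat_mul]; norm_num
    have a3 : Real.exp h * Real.exp (-h) = 1 := by rw [← Real.exp_add]; simp
    rw [sub_eq_add_neg, Real.exp_add, Real.exp_add, a1, a2]
    linear_combination (- Real.exp (-γ) ^ 2 * (Real.exp h * Real.exp (-h) + 1
      + 2 * Real.exp (-h) ^ 2)) * a3
  rw [e3]
  gcongr
  nlinarith [Real.exp_pos (-γ - h), Real.exp_pos (-γ + h)]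

/-- Configurations are paired by the flip at v. Within a pair the margin takes two values differing
by 2|x_v|, with weights in ratio 1 : r, so the second moment is at least the two-point variance. -/
theorem sum_gibbsProb_mul_margin_sq_ge {p : ℕ} {θ : Params p} {γ : ℝ} (hθ : WidthLE θ γ)
    {u v : Fin p} (hvu : v ≠ u) (x : EuclideanSpace ℝ (Fin p)) :
    Real.exp (-2 * γ) * x v ^ 2 ≤ ∑ σ, gibbsProb θ σ * margin x u σ ^ 2 := by
  have key : ∀ σ, Real.exp (-2 * γ) * x v ^ 2 * (gibbsProb θ σ + gibbsProb θ (flip v σ)) ≤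
      gibbsProb θ σ * margin x u σ ^ 2 +
        gibbsProb θ (flip v σ) * margin x u (flip v σ) ^ 2 := by
    intro σ
    have hh : |margin (localParam θ v) v σ| ≤ γ :=
      (abs_margin_le _ _ _).trans (localParam_mem_l1Ball hθ v)
    have h1 := exp_add_exp_neg_sq_le hh
    rw [gibbsProb_flip, margin_flip_of_ne x hvu]
    set r := Real.exp (-2 * margin (localParam θ v) v σ) with hr
    have hr0 : 0 < r := Real.exp_pos _
    set M := margin x u σ
    have hs : screen u σ v ^ 2 = 1 := by rw [← sq_abs, abs_screen, one_pow]
    have hb : x v ^ 2 = (x v * screen u σ v) ^ 2 := by rw [mul_pow, hs, mul_one]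
    rw [hb]
    set b := x v * screen u σ v
    have hg := gibbsProb_pos θ σ
    have h3 : Real.exp (-2 * γ) * b ^ 2 * (1 + r) ≤ M ^ 2 + r * (M - 2 * b) ^ 2 := by
      have h4 : (1 + r) * (Real.exp (-2 * γ) * b ^ 2 * (1 + r)) ≤
          (1 + r) * (M ^ 2 + r * (M - 2 * b) ^ 2) := by
        have h5 := mul_le_mul_of_nonneg_right h1 (sq_nonneg b)
        -- With N = M - 2b: (1+r)(M^2 + rN^2) = (M + rN)^2 + 4rb^2.
        nlinarith [sq_nonneg (M + r * (M - 2 * b))]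
      exact le_of_mul_le_mul_left h4 (by positivity)
    have := mul_le_mul_of_nonneg_left h3 hg.le
    linarith
  have hsum := Finset.sum_le_sum fun σ (_ : σ ∈ Finset.univ) => key σ
  rw [← Finset.mul_sum, Finset.sum_add_distrib, Finset.sum_add_distrib,
    sum_flip v (fun σ => gibbsProb θ σ),
    sum_flip v (fun σ => gibbsProb θ σ * margin x u σ ^ 2), sum_gibbsProb] at hsum
  linarith

/-- For z ≥ 0 this is e^z ≥ 1 + z rewritten; for z ≤ 0 the bound e^{-z} - 1 ≥ -z even gives z^2 on
the left. -/
theorem sq_div_one_add_abs_le (z : ℝ) : z ^ 2 / (1 + |z|) ≤ z * (1 - Real.exp (-z)) := by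
  have h0 : 0 < 1 + |z| := by positivity
  rw [div_le_iff₀ h0]
  rcases le_total 0 z with hz | hz
  · rw [abs_of_nonneg hz]
    have h1 : Real.exp (-z) * (1 + z) ≤ 1 := by
      have h2 := Real.add_one_le_exp z
      calc Real.exp (-z) * (1 + z) ≤ Real.exp (-z) * Real.exp z := by gcongr; linarith
        _ = 1 := by rw [← Real.exp_add]; simp
    nlinarith
  · rw [abs_of_nonpos hz]
    have h2 := Real.add_one_le_exp (-z)
    nlinarith [mul_nonneg (neg_nonneg.2 hz) (sub_nonneg.2 h2), mul_nonneg (sq_nonneg z) (sub_nonneg.2 h2), sq_nonneg z, mul_nonneg (sq_nonneg z) (neg_nonneg.2 hz)]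

theorem screening_strongly_monotone {p : ℕ} {θ : Params p} {γ : ℝ} (hθ : WidthLE θ γ)
    {u v : Fin p} (hvu : v ≠ u) {x : EuclideanSpace ℝ (Fin p)} (hx : x ∈ l1Ball p γ) :
    Real.exp (-3 * γ) / (1 + 2 * γ) * (x v - localParam θ u v) ^ 2 ≤
      ∑ σ, gibbsProb θ σ * (-(margin (x - localParam θ u) u σ * Real.exp (-margin x u σ))) := by
  have hγ : 0 ≤ γ := le_trans (Finset.sum_nonneg fun j _ => abs_nonneg (x j)) hx
  have h0 := sum_gibbsProb_mul_margin_mul_exp θ u (x - localParam θ u)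
  have hv := sum_gibbsProb_mul_margin_sq_ge hθ hvu (x - localParam θ u)
  -- The last summand has mean zero by `h0`; adding it turns -z exp(-margin(x)) into
  -- exp(-margin(x*)) z (1 - exp(-z)), which is nonnegative pointwise.
  have hpt : ∀ σ, Real.exp (-γ) / (1 + 2 * γ) * (gibbsProb θ σ *
      margin (x - localParam θ u) u σ ^ 2) ≤
      gibbsProb θ σ * (-(margin (x - localParam θ u) u σ * Real.exp (-margin x u σ))) +
      gibbsProb θ σ * (margin (x - localParam θ u) u σ *
        Real.exp (-margin (localParam θ u) u σ)) := by
    intro σ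
    have hx' : |margin x u σ| ≤ γ := (abs_margin_le _ _ _).trans hx
    have hl : |margin (localParam θ u) u σ| ≤ γ :=
      (abs_margin_le _ _ _).trans (localParam_mem_l1Ball hθ u)
    have hz : |margin (x - localParam θ u) u σ| ≤ 2 * γ := by
      rw [margin_sub]; exact (abs_sub _ _).trans (by linarith)
    have e : Real.exp (-margin x u σ) = Real.exp (-margin (localParam θ u) u σ) *
        Real.exp (-margin (x - localParam θ u) u σ) := by
      rw [← Real.exp_add, margin_sub]; ring_nf
    rw [e]
    set z := margin (x - localParam θ u) u σ
    set l := margin (localParam θ u) u σ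
    have h1 : z ^ 2 / (1 + 2 * γ) ≤ z * (1 - Real.exp (-z)) :=
      le_trans (by gcongr) (sq_div_one_add_abs_le z)
    have h2 : Real.exp (-γ) ≤ Real.exp (-l) := Real.exp_le_exp.2 (by linarith [(abs_le.1 hl).2])
    have h3 : Real.exp (-γ) * (z ^ 2 / (1 + 2 * γ)) ≤
        Real.exp (-l) * (z * (1 - Real.exp (-z))) := by gcongr
    have := mul_le_mul_of_nonneg_left h3 (gibbsProb_pos θ σ).le
    calc _ = gibbsProb θ σ * (Real.exp (-γ) * (z ^ 2 / (1 + 2 * γ))) := by ring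
      _ ≤ _ := this
      _ = _ := by ring
  have hsum := Finset.sum_le_sum fun σ (_ : σ ∈ Finset.univ) => hpt σ
  rw [← Finset.mul_sum, Finset.sum_add_distrib, h0, add_zero] at hsum
  refine le_trans ?_ hsum
  have e3 : Real.exp (-3 * γ) = Real.exp (-γ) * Real.exp (-2 * γ) := by
    rw [← Real.exp_add]; ring_nf
  have := mul_le_mul_of_nonneg_left hv
    (show 0 ≤ Real.exp (-γ) / (1 + 2 * γ) by positivity)
  refine le_trans (le_of_eq ?_) this
  rw [e3, PiLp.sub_apply]; ring

/-! ### The approximate gradient -/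

theorem sum_piAntidiag_factorial {p : ℕ} (z : Fin p → ℝ) (k : ℕ) :
    ∑ m ∈ Finset.piAntidiag (Finset.univ : Finset (Fin p)) k,
      (k.factorial : ℝ) * (∏ j, z j ^ m j) / ∏ j, ((m j).factorial : ℝ) = (∑ j, z j) ^ k := by
  rw [Finset.sum_pow_eq_sum_piAntidiag]
  refine Finset.sum_congr rfl fun m hm => ?_
  have h := Nat.multinomial_spec (Finset.univ : Finset (Fin p)) m
  rw [(Finset.mem_piAntidiag.1 hm).1] at h
  have h0 : (∏ j, ((m j).factorial : ℝ)) ≠ 0 :=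
    Finset.prod_ne_zero_iff.2 fun j _ => by positivity
  rw [← h]
  push_cast
  field_simp

/-- Every factor `screen u σ j` carries one σ_u, including j = u, so a monomial of degree k
contributes σ_u^k; even powers of spins are then dropped. -/
theorem prod_reducedSet {p : ℕ} (u w : Fin p) {k : ℕ} {m : Fin p → ℕ}
    (hm : m ∈ Finset.piAntidiag Finset.univ k) (σ : Config p) :
    ∏ j ∈ reducedSet u w k m, spin σ j = screen u σ w * ∏ j, screen u σ j ^ m j := by
  have hpow : ∀ (j : Fin p) (e : ℕ), spin σ j ^ e = if Odd e then spin σ j else 1 := by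
    intro j e
    have h1 : spin σ j ^ 2 = 1 := by rw [sq, spin_mul_self]
    split_ifs with h
    · obtain ⟨r, rfl⟩ := h
      rw [pow_succ, pow_mul, h1, one_pow, one_mul]
    · obtain ⟨r, rfl⟩ := Nat.not_odd_iff_even.1 h
      rw [← two_mul, pow_mul, h1, one_pow]
  have h1 : ∏ j ∈ reducedSet u w k m, spin σ j = ∏ j, spin σ j ^ monomialExponent u w k m j := by
    rw [reducedSet, Finset.prod_filter]
    exact Finset.prod_congr rfl fun j _ => (hpow j _).symm
  have hk : ∑ j, m j = k := (Finset.mem_piAntidiag.1 hm).1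
  have h2 : ∏ j, spin σ j ^ (if j = w ∧ w ≠ u then 1 else 0) =
      if w = u then 1 else spin σ w := by
    by_cases hw : w = u
    · simp [hw]
    · simp [hw, Finset.prod_ite_eq']
  have h3 : ∏ j, spin σ j ^ (if j = u then k + 1 else m j) =
      spin σ u * ∏ j, screen u σ j ^ m j := by
    have h4 : ∀ j, screen u σ j ^ m j =
        spin σ u ^ m j * spin σ j ^ (if j = u then 0 else m j) := by
      intro j
      unfold screen
      split_ifs with h
      · simp
      · rw [mul_pow]
    simp_rw [h4]
    rw [Finset.prod_mul_distrib, Finset.prod_pow_eq_pow_sum, hk,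
      ← Finset.mul_prod_erase _ _ (Finset.mem_univ u),
      ← Finset.mul_prod_erase Finset.univ (fun j => spin σ j ^ (if j = u then 0 else m j))
        (Finset.mem_univ u)]
    simp only [if_true, pow_zero, one_mul]
    rw [pow_succ', mul_assoc]
    congr 2
    exact Finset.prod_congr rfl fun j hj => by simp [Finset.ne_of_mem_erase hj]
  rw [h1]
  simp only [monomialExponent, pow_add]
  rw [Finset.prod_mul_distrib, h2, h3]
  unfold screen
  split_ifs <;> ring

/-- The exact expectation of `∏_{u ∈ K} σ_u`. -/
def gibbsMoment {p : ℕ} (θ : Params p) (K : Finset (Fin p)) : ℝ :=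
  ∑ σ, gibbsProb θ σ * ∏ u ∈ K, spin σ u

/-- The gradient of the interaction screening loss. -/
def screeningGrad {p : ℕ} (θ : Params p) (u : Fin p) (x : EuclideanSpace ℝ (Fin p)) :
    EuclideanSpace ℝ (Fin p) :=
  WithLp.toLp 2 fun w => -∑ σ, gibbsProb θ σ * (screen u σ w * Real.exp (-margin x u σ))

theorem approxGrad_sub {p d : ℕ} (S S' : StatIndex p (momentOrder d) → ℝ) (u : Fin p)
    (x : EuclideanSpace ℝ (Fin p)) :
    approxGrad S u x - approxGrad S' u x = approxGrad (fun K => S K - S' K) u x := by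
  ext w
  simp only [approxGrad, PiLp.sub_apply, mul_sub, Finset.sum_sub_distrib]
  ring

/-- By the multinomial theorem the absolute coefficients of degree k sum to ‖x‖₁^k, so all of them
together weigh at most e^γ. Applied to moment errors and, with c = 1, to the gradient norm. -/
theorem abs_approxGrad_le {p d : ℕ} {S : StatIndex p (momentOrder d) → ℝ} {c γ : ℝ}
    (hS : ∀ K, |S K| ≤ c) (hc : 0 ≤ c) (u w : Fin p) {x : EuclideanSpace ℝ (Fin p)}
    (hx : x ∈ l1Ball p γ) : |approxGrad S u x w| ≤ Real.exp γ * c := by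
  have hx0 : 0 ≤ ∑ j, |x j| := Finset.sum_nonneg fun j _ => abs_nonneg (x j)
  have hin : ∀ k : Fin (d + 1), |((-1 : ℝ) ^ (k : ℕ) / ((k : ℕ).factorial : ℝ)) *
      ∑ m ∈ (Finset.piAntidiag (Finset.univ : Finset (Fin p)) (k : ℕ)).attach,
        multinomialCoeff x k m.1 * S ⟨reducedSet u w k m.1, card_reducedSet_le k.2 u w m.2⟩| ≤
      (∑ j, |x j|) ^ (k : ℕ) / ((k : ℕ).factorial : ℝ) * c := by
    intro k
    have h1 : |∑ m ∈ (Finset.piAntidiag (Finset.univ : Finset (Fin p)) (k : ℕ)).attach,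
        multinomialCoeff x k m.1 * S ⟨reducedSet u w k m.1, card_reducedSet_le k.2 u w m.2⟩| ≤
        (∑ j, |x j|) ^ (k : ℕ) * c := by
      have h2 : ∀ m : Fin p → ℕ, |multinomialCoeff x k m| =
          ((k : ℕ).factorial : ℝ) * (∏ j, |x j| ^ m j) / ∏ j, ((m j).factorial : ℝ) := fun m => by
        simp [multinomialCoeff, abs_div, abs_mul, Finset.abs_prod, abs_pow]
      rw [← sum_piAntidiag_factorial, Finset.sum_mul, ← Finset.sum_attach (Finset.piAntidiag _ _)]
      refine (Finset.abs_sum_le_sum_abs _ _).trans (Finset.sum_le_sum fun m _ => ?_)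
      rw [abs_mul, ← h2]
      exact mul_le_mul_of_nonneg_left (hS _) (abs_nonneg _)
    rw [abs_mul, abs_div, abs_pow, abs_neg, abs_one, one_pow, Nat.abs_cast]
    calc _ ≤ 1 / ((k : ℕ).factorial : ℝ) * ((∑ j, |x j|) ^ (k : ℕ) * c) := by gcongr
      _ = _ := by ring
  calc |approxGrad S u x w|
      ≤ ∑ k : Fin (d + 1), (∑ j, |x j|) ^ (k : ℕ) / ((k : ℕ).factorial : ℝ) * c := by
        simp only [approxGrad, abs_neg]
        exact (Finset.abs_sum_le_sum_abs _ _).trans (Finset.sum_le_sum fun k _ => hin k)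
    _ = (∑ k ∈ Finset.range (d + 1), (∑ j, |x j|) ^ k / (k.factorial : ℝ)) * c := by
        rw [Finset.sum_range, Finset.sum_mul]
    _ ≤ Real.exp γ * c := by
        gcongr
        exact (Real.sum_le_exp_of_nonneg hx0 _).trans (Real.exp_le_exp.2 hx)

theorem approxGrad_gibbsMoment {p d : ℕ} (θ : Params p) (u w : Fin p)
    (x : EuclideanSpace ℝ (Fin p)) :
    approxGrad (d := d) (fun K => gibbsMoment θ K.1) u x w =
      -∑ σ, gibbsProb θ σ * (screen u σ w *
        ∑ k ∈ Finset.range (d + 1), (-margin x u σ) ^ k / (k.factorial : ℝ)) := by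
  have hin : ∀ k : ℕ, ∑ m ∈ Finset.piAntidiag (Finset.univ : Finset (Fin p)) k,
      multinomialCoeff x k m * gibbsMoment θ (reducedSet u w k m) =
      ∑ σ, gibbsProb θ σ * (screen u σ w * margin x u σ ^ k) := by
    intro k
    simp only [gibbsMoment, margin, ← sum_piAntidiag_factorial, Finset.mul_sum]
    rw [Finset.sum_comm]
    refine Finset.sum_congr rfl fun σ _ => Finset.sum_congr rfl fun m hm => ?_
    rw [prod_reducedSet u w hm]
    simp only [multinomialCoeff, mul_pow, Finset.prod_mul_distrib]
    ring
  simp only [approxGrad]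
  congr 1
  have hatt : ∀ k : Fin (d + 1),
      ∑ m ∈ (Finset.piAntidiag (Finset.univ : Finset (Fin p)) (k : ℕ)).attach,
        multinomialCoeff x k m.1 * gibbsMoment θ (reducedSet u w k m.1) =
      ∑ σ, gibbsProb θ σ * (screen u σ w * margin x u σ ^ (k : ℕ)) := fun k => by
    rw [← hin, ← Finset.sum_attach (Finset.piAntidiag (Finset.univ : Finset (Fin p)) (k : ℕ))]
  simp only [hatt, Finset.sum_range, Finset.mul_sum]
  rw [Finset.sum_comm]
  refine Finset.sum_congr rfl fun σ _ => Finset.sum_congr rfl fun k _ => ?_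
  rw [neg_pow]
  ring

/-- Once n ≥ 2γ, successive tail terms at least halve, so the tail is at most twice its first term.
-/
theorem abs_exp_sub_taylor_le {z γ : ℝ} {n : ℕ} (hz : |z| ≤ γ) (hn : 2 * γ ≤ n) :
    |Real.exp z - ∑ k ∈ Finset.range n, z ^ k / (k.factorial : ℝ)| ≤
      2 * γ ^ n / (n.factorial : ℝ) := by
  have h := Complex.exp_bound' (x := (z : ℂ)) (n := n) (by
    rw [Complex.norm_real, Real.norm_eq_abs, div_le_iff₀ (by positivity)]
    push_cast
    linarith)
  rw [Complex.norm_real, Real.norm_eq_abs] at h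
  have h2 : (Complex.exp z - ∑ m ∈ Finset.range n, (z : ℂ) ^ m / m.factorial) =
      ((Real.exp z - ∑ k ∈ Finset.range n, z ^ k / (k.factorial : ℝ) : ℝ) : ℂ) := by
    push_cast; rfl
  rw [h2, Complex.norm_real, Real.norm_eq_abs] at h
  refine h.trans ?_
  rw [mul_comm, mul_div_assoc]
  gcongr

/-- The comparison passes through the approximate gradient at the exact moments: linearity in `S`
handles the sampling error, Taylor's bound the truncation. -/
theorem abs_approxGrad_sub_screeningGrad_le {p d : ℕ} {θ : Params p}
    {S : StatIndex p (momentOrder d) → ℝ} {c γ : ℝ} (hc : 0 ≤ c)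
    (hS : ∀ K, |S K - gibbsMoment θ K.1| ≤ c) (hd : 2 * γ ≤ (d + 1 : ℕ)) (u w : Fin p)
    {x : EuclideanSpace ℝ (Fin p)} (hx : x ∈ l1Ball p γ) :
    |approxGrad S u x w - screeningGrad θ u x w| ≤
      Real.exp γ * c + 2 * γ ^ (d + 1) / ((d + 1).factorial : ℝ) := by
  have h1 : |approxGrad S u x w - approxGrad (d := d) (fun K => gibbsMoment θ K.1) u x w| ≤
      Real.exp γ * c := by
    rw [← PiLp.sub_apply, approxGrad_sub]
    exact abs_approxGrad_le hS hc u w hx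
  have h2 : |approxGrad (d := d) (fun K => gibbsMoment θ K.1) u x w - screeningGrad θ u x w| ≤
      2 * γ ^ (d + 1) / ((d + 1).factorial : ℝ) := by
    rw [approxGrad_gibbsMoment]
    simp only [screeningGrad]
    rw [neg_sub_neg, ← Finset.sum_sub_distrib]
    refine (Finset.abs_sum_le_sum_abs _ _).trans ?_
    rw [← one_mul (2 * γ ^ (d + 1) / ((d + 1).factorial : ℝ)), ← sum_gibbsProb θ, Finset.sum_mul]
    refine Finset.sum_le_sum fun σ _ => ?_
    rw [← mul_sub, ← mul_sub, abs_mul, abs_mul, abs_screen, one_mul, abs_of_pos (gibbsProb_pos θ σ)]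
    refine mul_le_mul_of_nonneg_left (abs_exp_sub_taylor_le ?_ hd) (gibbsProb_pos θ σ).le
    rw [abs_neg]
    exact (abs_margin_le x u σ).trans hx
  exact (abs_sub_le _ _ _).trans (add_le_add h1 h2)

theorem sum_screeningGrad_mul {p : ℕ} (θ : Params p) (u : Fin p)
    (x y : EuclideanSpace ℝ (Fin p)) :
    ∑ w, screeningGrad θ u x w * y w =
      ∑ σ, gibbsProb θ σ * (-(margin y u σ * Real.exp (-margin x u σ))) := by
  simp only [screeningGrad, margin, Finset.sum_mul, neg_mul, Finset.mul_sum, mul_neg,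
    Finset.sum_neg_distrib]
  rw [Finset.sum_comm]
  congr 1
  refine Finset.sum_congr rfl fun σ _ => Finset.sum_congr rfl fun k _ => ?_
  ring

/-! ### Projected gradient descent -/

theorem convex_l1Ball (p : ℕ) (γ : ℝ) : Convex ℝ (l1Ball p γ) := by
  intro x hx y hy a b ha hb hab
  simp only [l1Ball, Set.mem_ofPred_eq, PiLp.add_apply, PiLp.smul_apply, smul_eq_mul] at *
  calc ∑ j, |a * x j + b * y j| ≤ ∑ j, (a * |x j| + b * |y j|) := by
        refine Finset.sum_le_sum fun j _ => (abs_add_le _ _).trans (le_of_eq ?_)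
        rw [abs_mul, abs_mul, abs_of_nonneg ha, abs_of_nonneg hb]
    _ = a * ∑ j, |x j| + b * ∑ j, |y j| := by
        rw [Finset.sum_add_distrib, Finset.mul_sum, Finset.mul_sum]
    _ ≤ a * γ + b * γ := by gcongr
    _ = γ := by rw [← add_mul, hab, one_mul]

/-- At the nearest point of a convex set, the directions to x and to z form an obtuse or right
angle. -/
theorem norm_l1Proj_sub_sq_le {p : ℕ} {γ : ℝ} (hγ : 0 ≤ γ) (x : EuclideanSpace ℝ (Fin p))
    {z : EuclideanSpace ℝ (Fin p)} (hz : z ∈ l1Ball p γ) :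
    ‖l1Proj γ x - z‖ ^ 2 ≤ ‖x - z‖ ^ 2 := by
  obtain ⟨hmem, hmin⟩ := l1Proj_spec hγ x
  have hne : Nonempty (l1Ball p γ) := ⟨⟨z, hz⟩⟩
  have h : ‖x - l1Proj γ x‖ = ⨅ w : l1Ball p γ, ‖x - w‖ := by
    refine le_antisymm (le_ciInf fun w => ?_) ?_
    · simpa [dist_eq_norm] using hmin w w.2
    · exact ciInf_le ⟨0, by rintro _ ⟨w, rfl⟩; exact norm_nonneg _⟩
        (⟨l1Proj γ x, hmem⟩ : l1Ball p γ)
  have h2 := (norm_eq_iInf_iff_real_inner_le_zero (convex_l1Ball p γ) hmem).1 h z hz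
  have h3 : x - z = (x - l1Proj γ x) - (z - l1Proj γ x) := by abel
  rw [h3, norm_sub_rev (l1Proj γ x) z, norm_sub_sq_real (x - l1Proj γ x)]
  nlinarith [sq_nonneg ‖x - l1Proj γ x‖]

theorem norm_sq_le_of_mem_l1Ball {p : ℕ} {γ : ℝ} {z : EuclideanSpace ℝ (Fin p)}
    (hz : z ∈ l1Ball p γ) : ‖z‖ ^ 2 ≤ γ ^ 2 := by
  rw [EuclideanSpace.norm_sq_eq]
  have h0 : 0 ≤ ∑ j, |z j| := Finset.sum_nonneg fun j _ => abs_nonneg (z j)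
  refine le_trans ?_ (pow_le_pow_left₀ h0 hz 2)
  simp only [Real.norm_eq_abs]
  exact Finset.sum_sq_le_sq_sum_of_nonneg fun j _ => abs_nonneg (z j)

theorem iterate_mem_l1Ball {p d : ℕ} (S : StatIndex p (momentOrder d) → ℝ) {γ : ℝ} (hγ : 0 ≤ γ)
    (η : ℝ) (u : Fin p) (t : ℕ) : iterate S γ η u t ∈ l1Ball p γ := by
  cases t with
  | zero => simpa [iterate, l1Ball] using hγ
  | succ t => exact (l1Proj_spec hγ _).1

theorem projectedGradient_regret {p d : ℕ} {S : StatIndex p (momentOrder d) → ℝ} {γ η G : ℝ}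
    (hγ : 0 ≤ γ) (u : Fin p) (hG : ∀ t, ‖approxGrad S u (iterate S γ η u t)‖ ^ 2 ≤ G)
    {z : EuclideanSpace ℝ (Fin p)} (hz : z ∈ l1Ball p γ) (T : ℕ) :
    2 * η * ∑ t ∈ Finset.range T,
      inner ℝ (approxGrad S u (iterate S γ η u t)) (iterate S γ η u t - z) ≤
      γ ^ 2 + T * (η ^ 2 * G) := by
  -- Keeping the final squared distance on the left makes the sum telescope. The initial distance is
  -- ‖z‖ ≤ γ because the descent starts at 0.
  suffices h : 2 * η * ∑ t ∈ Finset.range T,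
      inner ℝ (approxGrad S u (iterate S γ η u t)) (iterate S γ η u t - z) +
      ‖iterate S γ η u T - z‖ ^ 2 ≤ γ ^ 2 + T * (η ^ 2 * G) by
    nlinarith [sq_nonneg ‖iterate S γ η u T - z‖]
  induction T with
  | zero => simpa [iterate] using norm_sq_le_of_mem_l1Ball hz
  | succ T ih =>
    have h1 := norm_l1Proj_sub_sq_le hγ
      (iterate S γ η u T - η • approxGrad S u (iterate S γ η u T)) hz
    rw [sub_right_comm, norm_sub_sq_real (iterate S γ η u T - z), real_inner_smul_right, norm_smul, mul_pow,
      Real.norm_eq_abs, sq_abs, real_inner_comm] at h1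
    have h2 := mul_le_mul_of_nonneg_left (hG T) (sq_nonneg η)
    rw [Finset.sum_range_succ]
    simp only [iterate]
    push_cast
    linarith

/-! ### The Taylor degree -/

theorem lambertW_pos {z : ℝ} (hz : 0 < z) : 0 < lambertW z := by
  have h := (lambertW_spec (z := z) (by linarith [Real.exp_pos (-1)])).2
  by_contra hw
  nlinarith [Real.exp_pos (lambertW z)]

theorem log_taylorArg_nonneg {γ ε : ℝ} (hε : 0 < ε) (hεγ : ε ≤ 4 * γ) :
    0 ≤ Real.log (16 * γ * (1 + γ) / ε ^ 2) := by
  have hγ : 0 < γ := by linarith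
  refine Real.log_nonneg ?_
  rw [le_div_iff₀ (by positivity)]
  nlinarith

theorem taylorDegree_spec {γ ε : ℝ} (hε : 0 < ε) (hεγ : ε ≤ 4 * γ) :
    2 * γ ≤ (taylorDegree γ ε + 1 : ℕ) ∧
      2 * γ ^ (taylorDegree γ ε + 1) / ((taylorDegree γ ε + 1).factorial : ℝ) ≤
        Real.exp (-3 * γ) * (ε ^ 2 / (16 * γ * (1 + γ))) := by
  have hγ : 0 < γ := by linarith
  have hA := log_taylorArg_nonneg hε hεγ
  have hexpA : Real.exp (-Real.log (16 * γ * (1 + γ) / ε ^ 2)) = ε ^ 2 / (16 * γ * (1 + γ)) := by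
    rw [Real.exp_neg, Real.exp_log (by positivity), inv_div]
  unfold taylorDegree
  set A := Real.log (16 * γ * (1 + γ) / ε ^ 2)
  set z := 3 / Real.exp 1 + A / (γ * Real.exp 1) with hz
  have hz0 : 0 < z := by positivity
  have hw := lambertW_pos hz0
  have hwz := (lambertW_spec (z := z) (by linarith [Real.exp_pos (-1)])).2
  set w := lambertW z
  have hB : 3 * γ + A = γ * Real.exp 1 * (w * Real.exp w) := by
    rw [hwz, hz]; field_simp
  -- The Lambert equation gives two readings of the quotient q defining k = d + 1: k ≥ γ e e^w
  -- yields γe/k ≤ e^{-w}, and kw ≥ 3γ + A yields (e^{-w})^k ≤ e^{-3γ-A}.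
  have hq : (3 * γ + A) / w = γ * Real.exp 1 * Real.exp w := by
    rw [hB]; field_simp
  have hq0 : 0 < (3 * γ + A) / w := by rw [hq]; positivity
  -- The ceiling is positive, so the truncated subtraction in the degree is exact.
  have hk1 : ⌈(3 * γ + A) / w⌉₊ - 1 + 1 = ⌈(3 * γ + A) / w⌉₊ :=
    Nat.sub_add_cancel (Nat.ceil_pos.2 hq0)
  rw [hk1]
  have hk := Nat.le_ceil ((3 * γ + A) / w)
  have hkpos : 1 ≤ ⌈(3 * γ + A) / w⌉₊ := Nat.ceil_pos.2 hq0
  set k := ⌈(3 * γ + A) / w⌉₊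
  have hkr : (1 : ℝ) ≤ k := by exact_mod_cast hkpos
  have he : 2 ≤ Real.exp 1 := by linarith [Real.add_one_le_exp (1 : ℝ)]
  constructor
  · refine le_trans ?_ hk
    rw [hq]
    have h1 : 1 ≤ Real.exp w := Real.one_le_exp hw.le
    calc 2 * γ = γ * 2 * 1 := by ring
      _ ≤ γ * Real.exp 1 * Real.exp w := by gcongr
  · have hst := Stirling.le_factorial_stirling k
    -- This Stirling factor absorbs the 2 of the Taylor remainder.
    have hsq : 2 ≤ √(2 * Real.pi * k) := by
      refine Real.le_sqrt_of_sq_le ?_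
      nlinarith [Real.pi_gt_three]
    have h2 : 2 * ((k : ℝ) / Real.exp 1) ^ k ≤ (k.factorial : ℝ) :=
      le_trans (by gcongr) hst
    have h3 : γ * Real.exp 1 / k ≤ Real.exp (-w) := by
      rw [div_le_iff₀ (by positivity)]
      rw [hq] at hk
      calc γ * Real.exp 1 = Real.exp (-w) * (γ * Real.exp 1 * Real.exp w) := by
            rw [Real.exp_neg]; field_simp
        _ ≤ Real.exp (-w) * k := by gcongr
    calc 2 * γ ^ k / (k.factorial : ℝ) ≤ 2 * γ ^ k / (2 * ((k : ℝ) / Real.exp 1) ^ k) := by gcongr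
      _ = (γ * Real.exp 1 / k) ^ k := by rw [mul_div_mul_left _ _ two_ne_zero, ← div_pow]; field_simp
      _ ≤ Real.exp (-w) ^ k := by gcongr
      _ = Real.exp (-(k * w)) := by rw [← Real.exp_nat_mul, mul_neg]
      _ ≤ Real.exp (-3 * γ + -A) := by
          refine Real.exp_le_exp.2 ?_
          rw [div_le_iff₀ hw] at hk
          linarith
      _ = _ := by rw [Real.exp_add, hexpA]

theorem taylorDegree_isBigO {ε : ℝ} (hε : 0 < ε) :
    (fun g : ℝ => (taylorDegree g ε : ℝ)) =O[Filter.atTop] (fun g : ℝ => g) := by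
  refine Asymptotics.IsBigO.of_bound (9 + 36 / ε) ?_
  filter_upwards [Filter.eventually_ge_atTop (max 1 ε)] with g hg
  have hg1 : 1 ≤ g := (le_max_left _ _).trans hg
  have hgε : ε ≤ g := (le_max_right _ _).trans hg
  rw [Real.norm_eq_abs, Real.norm_eq_abs, Nat.abs_cast, abs_of_pos (by linarith)]
  have hA := log_taylorArg_nonneg (γ := g) hε (by linarith)
  have hA2 : Real.log (16 * g * (1 + g) / ε ^ 2) ≤ 12 * g / ε := by
    have h1 : 16 * g * (1 + g) / ε ^ 2 ≤ (6 * g / ε) ^ 2 := by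
      rw [div_pow]; gcongr; nlinarith
    have h2 := Real.log_le_log (by positivity) h1
    rw [Real.log_pow] at h2
    have h3 := Real.log_le_sub_one_of_pos (show 0 < 6 * g / ε by positivity)
    have h4 : 12 * g / ε = 2 * (6 * g / ε) := by ring
    push_cast at h2
    linarith
  unfold taylorDegree
  set A := Real.log (16 * g * (1 + g) / ε ^ 2)
  have he : Real.exp 1 ^ 2 < 9 := by nlinarith [Real.exp_one_lt_d9, Real.exp_pos 1]
  set z := 3 / Real.exp 1 + A / (g * Real.exp 1)
  have hz3 : 3 / Real.exp 1 ≤ z := le_add_of_nonneg_right (by positivity)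
  have hz0 : 0 < z := lt_of_lt_of_le (by positivity) hz3
  have hwz := (lambertW_spec (z := z) (by linarith [Real.exp_pos (-1)])).2
  have hw0 := lambertW_pos hz0
  set w := lambertW z
  -- The argument of W never falls below 3/e, which exceeds e/3 because e^2 < 9. So W stays away
  -- from 0, and d is at most a constant times 3g + A.
  have hw : 1 / 3 ≤ w := by
    by_contra! hlt
    have h1 : w * Real.exp w ≤ 1 / 3 * Real.exp 1 := by gcongr; linarith
    have h2 : 1 / 3 * Real.exp 1 < 3 / Real.exp 1 := by
      rw [lt_div_iff₀ (Real.exp_pos 1)]; nlinarith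
    linarith
  have hB0 : 0 ≤ 3 * g + A := by positivity
  have hle : (3 * g + A) / w ≤ (9 + 36 / ε) * g := by
    calc (3 * g + A) / w ≤ (3 * g + A) / (1 / 3) := by gcongr
      _ = 9 * g + 3 * A := by ring
      _ ≤ 9 * g + 3 * (12 * g / ε) := by gcongr
      _ = _ := by ring
  refine le_trans ?_ hle
  have h1 := Nat.ceil_lt_add_one (show 0 ≤ (3 * g + A) / w by positivity)
  rcases Nat.eq_zero_or_pos ⌈(3 * g + A) / w⌉₊ with h0 | h0
  · rw [h0]; simp; positivity
  · rw [Nat.cast_sub h0]; push_cast; linarith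

/-! ### The error of the estimate on the event that all moments are accurate -/

/-- The accuracy of the empirical moments guaranteed by `numSamples` observations. -/
def momentAccuracy (γ ε : ℝ) : ℝ := ε ^ 2 / (8 * Real.exp (4 * γ) * γ * (1 + γ))

theorem sqrt_mul_numSteps_le {p : ℕ} {γ ε : ℝ} (hγ : 0 < γ) (hε : 0 < ε) :
    √((p : ℝ) * (numSteps p γ ε : ℝ)) ≤
      numSteps p γ ε * (ε ^ 2 / (24 * γ * Real.exp (4 * γ) * (1 + γ))) := by
  have hT : 576 * (p : ℝ) * γ ^ 2 * Real.exp (8 * γ) * (1 + γ) ^ 2 / ε ^ 4 ≤ numSteps p γ ε :=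
    Nat.le_ceil _
  have e : Real.exp (8 * γ) = Real.exp (4 * γ) ^ 2 := by rw [← Real.exp_nat_mul]; ring_nf
  refine Real.sqrt_le_iff.2 ⟨by positivity, ?_⟩
  rw [div_le_iff₀ (by positivity), e] at hT
  rw [mul_pow, div_pow, sq (numSteps p γ ε : ℝ), mul_assoc, mul_comm (p : ℝ)]
  refine mul_le_mul_of_nonneg_left ?_ (by positivity)
  rw [mul_div_assoc', le_div_iff₀ (by positivity)]
  linarith

/-- In units of e^{-3γ}ε²/(1+γ), per step, the regret costs 13/288, the moment error 1/4 and the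
Taylor remainder 1/8. The total 121/288 is below 1/2, hence within the monotonicity constant. -/
theorem total_error_le {p : ℕ} {γ ε : ℝ} (hp : 0 < p) (hγ : 0 < γ) (hε : 0 < ε) :
    (γ ^ 2 + numSteps p γ ε * (stepSize p γ ε ^ 2 * (p * Real.exp γ ^ 2))) /
        (2 * stepSize p γ ε) +
      numSteps p γ ε * (2 * γ * (Real.exp γ * momentAccuracy γ ε +
        Real.exp (-3 * γ) * (ε ^ 2 / (16 * γ * (1 + γ))))) ≤
      numSteps p γ ε * (Real.exp (-3 * γ) / (1 + 2 * γ) * ε ^ 2) := by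
  have hs := sqrt_mul_numSteps_le (p := p) hγ hε
  have hT : 0 < (numSteps p γ ε : ℝ) := by
    have : 0 < numSteps p γ ε := by
      unfold numSteps
      exact Nat.ceil_pos.2 (by positivity)
    exact_mod_cast this
  unfold stepSize
  set T := (numSteps p γ ε : ℝ)
  have hpr : 0 < (p : ℝ) := by exact_mod_cast hp
  have hs2 : √((p : ℝ) * T) ^ 2 = p * T := Real.sq_sqrt (by positivity)
  have hs0 : 0 < √((p : ℝ) * T) := Real.sqrt_pos.2 (by positivity)
  set s := √((p : ℝ) * T)
  have e1 : Real.exp (-γ) = (Real.exp γ)⁻¹ := Real.exp_neg γ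
  have e3 : Real.exp (-3 * γ) = (Real.exp γ ^ 3)⁻¹ := by
    rw [← Real.exp_nat_mul, ← Real.exp_neg]; push_cast; ring_nf
  have e4 : Real.exp (4 * γ) = Real.exp γ ^ 4 := by
    rw [← Real.exp_nat_mul]; push_cast; ring_nf
  unfold momentAccuracy
  rw [e4] at hs ⊢
  rw [e1, e3]
  have hE := Real.exp_pos γ
  set E := Real.exp γ
  have hfirst : (γ ^ 2 + T * ((2 * γ * E⁻¹ / (3 * s)) ^ 2 * (p * E ^ 2))) /
      (2 * (2 * γ * E⁻¹ / (3 * s))) = 13 / 12 * γ * E * s := by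
    have : T * ((2 * γ * E⁻¹ / (3 * s)) ^ 2 * (p * E ^ 2)) = 4 / 9 * γ ^ 2 := by
      calc _ = 4 / 9 * γ ^ 2 * (p * T) * (E⁻¹ * E) ^ 2 / s ^ 2 := by field_simp; ring
        _ = _ := by rw [← hs2, inv_mul_cancel₀ hE.ne']; field_simp
    rw [this]; field_simp; ring
  rw [hfirst]
  calc _ ≤ 13 / 12 * γ * E * (T * (ε ^ 2 / (24 * γ * E ^ 4 * (1 + γ)))) +
        T * (2 * γ * (E * (ε ^ 2 / (8 * E ^ 4 * γ * (1 + γ))) +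
          (E ^ 3)⁻¹ * (ε ^ 2 / (16 * γ * (1 + γ))))) := by gcongr
    _ = T * ((E ^ 3)⁻¹ * (121 / 144) / (2 + 2 * γ) * ε ^ 2) := by field_simp; ring
    _ ≤ T * ((E ^ 3)⁻¹ * 1 / (1 + 2 * γ) * ε ^ 2) := by gcongr <;> norm_num
    _ = _ := by rw [mul_one]

theorem abs_estimate_sub_le {p d : ℕ} {θ : Params p} {γ ε : ℝ} (hθ : WidthLE θ γ) (hε : 0 < ε)
    (hεγ : ε ≤ 4 * γ) (hd1 : 2 * γ ≤ (d + 1 : ℕ))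
    (hd2 : 2 * γ ^ (d + 1) / ((d + 1).factorial : ℝ) ≤
      Real.exp (-3 * γ) * (ε ^ 2 / (16 * γ * (1 + γ))))
    {S : StatIndex p (momentOrder d) → ℝ}
    (hS1 : ∀ K, |S K| ≤ 1) (hS : ∀ K, |S K - gibbsMoment θ K.1| ≤ momentAccuracy γ ε)
    {u v : Fin p} (hvu : v ≠ u) :
    |estimate d S γ (stepSize p γ ε) (numSteps p γ ε) u v - θ.coupling u v| ≤ ε := by
  have hγ : 0 < γ := by linarith
  have hp : 0 < p := u.pos
  have htot := total_error_le (p := p) hp hγ hε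
  have hTn : 0 < numSteps p γ ε := by
    unfold numSteps
    exact Nat.ceil_pos.2 (by positivity)
  have hη : 0 < stepSize p γ ε := by unfold stepSize; positivity
  have hacc : 0 ≤ momentAccuracy γ ε := by unfold momentAccuracy; positivity
  set η := stepSize p γ ε
  set T := numSteps p γ ε
  have hT : (0 : ℝ) < T := by exact_mod_cast hTn
  have hball := iterate_mem_l1Ball S hγ.le η u
  have hG : ∀ t, ‖approxGrad S u (iterate S γ η u t)‖ ^ 2 ≤ p * Real.exp γ ^ 2 := by
    intro t
    rw [EuclideanSpace.norm_sq_eq]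
    refine (Finset.sum_le_card_nsmul _ _ (Real.exp γ ^ 2) fun w _ => ?_).trans (le_of_eq ?_)
    · rw [Real.norm_eq_abs]
      have h := abs_approxGrad_le hS1 zero_le_one u w (hball t)
      rw [mul_one] at h
      exact pow_le_pow_left₀ (abs_nonneg _) h 2
    · simp
  have hz := localParam_mem_l1Ball hθ u
  have hreg := projectedGradient_regret hγ.le u hG hz T
  set q := Real.exp γ * momentAccuracy γ ε + Real.exp (-3 * γ) * (ε ^ 2 / (16 * γ * (1 + γ)))
  have hq0 : 0 ≤ q := by positivity
  set κ := Real.exp (-3 * γ) / (1 + 2 * γ) with hκ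
  have hκ0 : 0 < κ := by positivity
  have hstep : ∀ t, κ * (iterate S γ η u t v - θ.coupling u v) ^ 2 ≤
      inner ℝ (approxGrad S u (iterate S γ η u t)) (iterate S γ η u t - localParam θ u) +
        2 * γ * q := by
    intro t
    have h1 := screening_strongly_monotone hθ hvu (hball t)
    rw [← sum_screeningGrad_mul] at h1
    have hl : localParam θ u v = θ.coupling u v := by simp [localParam, hvu]
    rw [hl] at h1
    refine h1.trans ?_
    have h2 : inner ℝ (approxGrad S u (iterate S γ η u t)) (iterate S γ η u t - localParam θ u) =
        ∑ w, approxGrad S u (iterate S γ η u t) w * (iterate S γ η u t - localParam θ u) w := by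
      rw [PiLp.inner_apply]
      exact Finset.sum_congr rfl fun w _ => by simp [mul_comm]
    rw [h2, ← sub_le_iff_le_add', ← Finset.sum_sub_distrib]
    have h3 : ∑ w, |(iterate S γ η u t - localParam θ u) w| ≤ 2 * γ := by
      calc _ ≤ ∑ w, (|iterate S γ η u t w| + |localParam θ u w|) :=
            Finset.sum_le_sum fun w _ => abs_sub _ _
        _ ≤ γ + γ := by rw [Finset.sum_add_distrib]; exact add_le_add (hball t) hz
        _ = 2 * γ := by ring
    -- Hölder: the gradient error is at most q in sup norm, and x - x* has ℓ₁-norm at most 2γ.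
    calc _ ≤ ∑ w, q * |(iterate S γ η u t - localParam θ u) w| := by
          refine Finset.sum_le_sum fun w _ => ?_
          rw [← sub_mul]
          refine (le_abs_self _).trans ?_
          rw [abs_mul]
          refine mul_le_mul_of_nonneg_right ?_ (abs_nonneg _)
          rw [abs_sub_comm]
          exact (abs_approxGrad_sub_screeningGrad_le hacc hS hd1 u w (hball t)).trans
            (add_le_add le_rfl hd2)
      _ ≤ q * (2 * γ) := by rw [← Finset.mul_sum]; gcongr
      _ = 2 * γ * q := by ring
  have hsum := Finset.sum_le_sum fun t (_ : t ∈ Finset.range T) => hstep t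
  rw [← Finset.mul_sum, Finset.sum_add_distrib, Finset.sum_const, Finset.card_range,
    nsmul_eq_mul] at hsum
  have hreg' : ∑ t ∈ Finset.range T, inner ℝ (approxGrad S u (iterate S γ η u t))
      (iterate S γ η u t - localParam θ u) ≤
      (γ ^ 2 + T * (η ^ 2 * (p * Real.exp γ ^ 2))) / (2 * η) := by
    rw [le_div_iff₀ (by positivity)]; linarith
  have hsq : κ * ∑ t ∈ Finset.range T, (iterate S γ η u t v - θ.coupling u v) ^ 2 ≤
      κ * (T * ε ^ 2) := by
    calc _ ≤ _ := hsum.trans (add_le_add_left hreg' _)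
      _ ≤ _ := htot
      _ = _ := by ring
  have hsq' := le_of_mul_le_mul_left hsq hκ0
  have hcs := sq_sum_le_card_mul_sum_sq (s := Finset.range T)
    (f := fun t => iterate S γ η u t v - θ.coupling u v)
  rw [Finset.card_range] at hcs
  have hest : estimate d S γ η T u v - θ.coupling u v =
      (∑ t ∈ Finset.range T, (iterate S γ η u t v - θ.coupling u v)) / T := by
    rw [Finset.sum_sub_distrib, Finset.sum_const, Finset.card_range, nsmul_eq_mul, sub_div,
      mul_div_cancel_left₀ _ hT.ne']
    simp [estimate, div_eq_inv_mul]
  rw [hest]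
  refine abs_le_of_sq_le_sq ?_ hε.le
  rw [div_pow, div_le_iff₀ (by positivity)]
  calc _ ≤ (T : ℝ) * (T * ε ^ 2) := hcs.trans (by gcongr)
    _ = _ := by ring

/-! ### Concentration of the empirical moments -/

theorem integral_gibbsMeasure {p : ℕ} (θ : Params p) (f : Config p → ℝ) :
    ∫ σ, f σ ∂(gibbsMeasure θ) = ∑ σ, gibbsProb θ σ * f σ := by
  unfold gibbsMeasure
  rw [integral_finsetSum_measure fun σ _ =>
    (integrable_dirac (by simp)).smul_measure ENNReal.ofReal_ne_top]
  refine Finset.sum_congr rfl fun σ _ => ?_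
  rw [integral_smul_measure, integral_dirac, ENNReal.toReal_ofReal (gibbsProb_pos θ σ).le,
    smul_eq_mul]

theorem abs_empiricalMoment_le {p n : ℕ} (x : Fin n → Config p) (K : Finset (Fin p)) :
    |empiricalMoment x K| ≤ 1 := by
  unfold empiricalMoment
  rw [abs_mul, abs_of_nonneg (by positivity)]
  have h : |∑ i, ∏ u ∈ K, spin (x i) u| ≤ n := by
    refine (Finset.abs_sum_le_sum_abs _ _).trans (le_of_eq ?_)
    simp [abs_prod_spin]
  rw [one_div_mul_eq_div]
  exact div_le_one_of_le₀ h (by positivity)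

theorem measureReal_sum_ge_le {p n : ℕ} {θ : Params p} {Ω : Type*} [MeasurableSpace Ω]
    {P : Measure Ω} [IsProbabilityMeasure P] {X : Fin n → Ω → Config p}
    (hlaw : ∀ i, HasLaw (X i) (gibbsMeasure θ) P) (hindep : iIndepFun X P) {f : Config p → ℝ}
    (hf : ∀ σ, |f σ| ≤ 1) {c : ℝ} (hc : 0 ≤ c) :
    P.real {ω | n * c ≤ ∑ i, (f (X i ω) - ∑ σ, gibbsProb θ σ * f σ)} ≤
      Real.exp (-(n * c ^ 2 / 2)) := by
  have hmeas : Measurable f := Measurable.of_discrete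
  have hmean : ∀ i, P[fun ω => f (X i ω)] = ∑ σ, gibbsProb θ σ * f σ := fun i => by
    rw [← integral_gibbsMeasure, ← (hlaw i).integral_comp hmeas.aestronglyMeasurable]
    rfl
  have hsub : ∀ i ∈ (Finset.univ : Finset (Fin n)),
      HasSubgaussianMGF (fun ω => f (X i ω) - ∑ σ, gibbsProb θ σ * f σ) 1 P := by
    intro i _
    have h := hasSubgaussianMGF_of_mem_Icc (μ := P) (X := fun ω => f (X i ω)) (a := -1) (b := 1)
      (hmeas.comp_aemeasurable (hlaw i).aemeasurable)
      (Filter.Eventually.of_forall fun ω => abs_le.1 (hf (X i ω)))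
    rw [hmean] at h
    -- Hoeffding's lemma on [-1, 1]: half the width, squared, is the variance proxy 1.
    have h1 : ((‖(1 : ℝ) - -1‖₊ / 2) ^ 2) = 1 := by
      rw [← NNReal.coe_inj]; norm_num
    rwa [h1] at h
  have hind := hindep.comp (fun _ σ => f σ - ∑ τ, gibbsProb θ τ * f τ)
    (fun _ => Measurable.of_discrete)
  refine (HasSubgaussianMGF.measure_sum_ge_le_of_iIndepFun hind hsub (by positivity)).trans
    (le_of_eq ?_)
  congr 1
  simp
  -- For n = 0 the exponent divides by zero and is 0, as required.
  rcases Nat.eq_zero_or_pos n with h | h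
  · simp [h]
  · field_simp

theorem measureReal_empiricalMoment_le {p n : ℕ} (hn : 0 < n) {θ : Params p} {Ω : Type*}
    [MeasurableSpace Ω] {P : Measure Ω} [IsProbabilityMeasure P] {X : Fin n → Ω → Config p}
    (hlaw : ∀ i, HasLaw (X i) (gibbsMeasure θ) P) (hindep : iIndepFun X P) (K : Finset (Fin p))
    {c : ℝ} (hc : 0 ≤ c) :
    P.real {ω | c ≤ |empiricalMoment (fun i => X i ω) K - gibbsMoment θ K|} ≤
      2 * Real.exp (-(n * c ^ 2 / 2)) := by
  have h1 := measureReal_sum_ge_le hlaw hindep (f := fun σ => ∏ u ∈ K, spin σ u)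
    (fun σ => (abs_prod_spin σ K).le) hc
  have h2 := measureReal_sum_ge_le hlaw hindep (f := fun σ => -∏ u ∈ K, spin σ u)
    (fun σ => by rw [abs_neg]; exact (abs_prod_spin σ K).le) hc
  have hnr : (0 : ℝ) < n := by exact_mod_cast hn
  rw [two_mul]
  refine le_trans (measureReal_mono ?_) ((measureReal_union_le _ _).trans (add_le_add h1 h2))
  intro ω hω
  have hdev : (n : ℝ) * (empiricalMoment (fun i => X i ω) K - gibbsMoment θ K) =
      ∑ i, (∏ u ∈ K, spin (X i ω) u - ∑ σ, gibbsProb θ σ * ∏ u ∈ K, spin σ u) := by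
    simp only [empiricalMoment, gibbsMoment, Finset.sum_sub_distrib, Finset.sum_const,
      Finset.card_univ, Fintype.card_fin, nsmul_eq_mul]
    field_simp
  rcases le_abs.1 (show c ≤ |_| from hω) with h | h
  · left
    change n * c ≤ _
    rw [← hdev]
    gcongr
  · right
    change n * c ≤ _
    simp only [mul_neg, Finset.sum_neg_distrib, sub_neg_eq_add]
    have h3 := mul_le_mul_of_nonneg_left h hnr.le
    rw [mul_neg, hdev, ← Finset.sum_neg_distrib] at h3
    refine h3.trans (le_of_eq (Finset.sum_congr rfl fun i _ => by ring))

/-- A set of at most D sites is determined by its list padded with `none` to length D, and each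
entry has p + 1 possible values. -/
theorem card_statIndex_le (p D : ℕ) : Fintype.card (StatIndex p D) ≤ (p + 1) ^ D := by
  have h : Function.Injective
      (fun (K : StatIndex p D) (i : Fin D) => K.1.toList[(i : ℕ)]?) := by
    intro K L hKL
    have hlist : K.1.toList = L.1.toList := List.ext_getElem? fun i => by
      by_cases hi : i < D
      · exact congrFun hKL ⟨i, hi⟩
      · rw [List.getElem?_eq_none, List.getElem?_eq_none]
        · rw [Finset.length_toList]; exact L.2.trans (not_lt.1 hi)
        · rw [Finset.length_toList]; exact K.2.trans (not_lt.1 hi)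
    exact Subtype.ext (by rw [← Finset.toList_toFinset K.1, hlist, Finset.toList_toFinset])
  simpa using Fintype.card_le_of_injective _ h

theorem two_mul_card_mul_exp_le {p : ℕ} (hp : 0 < p) {γ ε δ : ℝ} (hγ : 0 < γ) (hε : 0 < ε)
    (hδ : 0 < δ) :
    Fintype.card (StatIndex p (momentOrder (taylorDegree γ ε))) *
      (2 * Real.exp (-(numSamples p γ ε δ * momentAccuracy γ ε ^ 2 / 2))) ≤ δ := by
  have hpr : (1 : ℝ) ≤ p := by exact_mod_cast hp
  have hn : 2 ^ 7 * Real.exp (8 * γ) * γ ^ 2 * (1 + γ) ^ 2 *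
      ((((taylorDegree γ ε : ℝ) + 2) * Real.log (Real.exp 1 * (p : ℝ)) +
        Real.log (2 * (p : ℝ) * ((taylorDegree γ ε : ℝ) + 2) / δ)) / ε ^ 4) ≤
      numSamples p γ ε δ := Nat.le_ceil _
  have hcard : (Fintype.card (StatIndex p (momentOrder (taylorDegree γ ε))) : ℝ) ≤
      (Real.exp 1 * p) ^ (taylorDegree γ ε + 2) := by
    have hD : momentOrder (taylorDegree γ ε) ≤ taylorDegree γ ε + 2 := Nat.sub_le _ _
    calc _ ≤ (((p + 1) ^ momentOrder (taylorDegree γ ε) : ℕ) : ℝ) := by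
          exact_mod_cast card_statIndex_le p _
      _ ≤ ((p : ℝ) + 1) ^ (taylorDegree γ ε + 2) := by
          push_cast
          exact pow_le_pow_right₀ (by linarith) hD
      _ ≤ _ := by
          gcongr
          nlinarith [Real.add_one_le_exp (1 : ℝ)]
  have e : Real.exp (8 * γ) = Real.exp (4 * γ) ^ 2 := by rw [← Real.exp_nat_mul]; ring_nf
  set d := taylorDegree γ ε
  set n := numSamples p γ ε δ
  set L := ((d : ℝ) + 2) * Real.log (Real.exp 1 * (p : ℝ)) +
        Real.log (2 * (p : ℝ) * ((d : ℝ) + 2) / δ) with hL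
  have hLn : L ≤ n * momentAccuracy γ ε ^ 2 / 2 := by
    have hpos : 0 ≤ momentAccuracy γ ε ^ 2 / 2 := by positivity
    calc L = 2 ^ 7 * Real.exp (8 * γ) * γ ^ 2 * (1 + γ) ^ 2 * (L / ε ^ 4) *
          (momentAccuracy γ ε ^ 2 / 2) := by
            rw [e]; unfold momentAccuracy; field_simp; norm_num
      _ ≤ n * (momentAccuracy γ ε ^ 2 / 2) := mul_le_mul_of_nonneg_right hn hpos
      _ = _ := by ring
  have hexpL : Real.exp (-L) = δ / (2 * p * (d + 2) * (Real.exp 1 * p) ^ (d + 2)) := by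
    have h1 : ((d : ℝ) + 2) * Real.log (Real.exp 1 * (p : ℝ)) =
        Real.log ((Real.exp 1 * (p : ℝ)) ^ (d + 2)) := by
      rw [Real.log_pow]; push_cast; ring
    rw [hL, h1, Real.exp_neg, Real.exp_add, Real.exp_log (by positivity),
      Real.exp_log (by positivity)]
    field_simp
  calc _ ≤ (Real.exp 1 * p) ^ (d + 2) * (2 * Real.exp (-L)) := by gcongr
    -- The union bound needs only log(2/δ) beyond the counting term; the remaining factor p(d+2) is
    -- slack.
    _ = δ / (p * (d + 2)) := by rw [hexpL]; field_simp
    _ ≤ δ := div_le_self hδ.le (by nlinarith [(Nat.cast_nonneg d : (0 : ℝ) ≤ d)])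

theorem numSamples_pos {p : ℕ} (hp : 0 < p) {γ ε δ : ℝ} (hγ : 0 < γ) (hε : 0 < ε)
    (hδ : 0 < δ) (hδ1 : δ < 1) : 0 < numSamples p γ ε δ := by
  have hpr : (1 : ℝ) ≤ p := by exact_mod_cast hp
  have h1 : 0 ≤ Real.log (Real.exp 1 * (p : ℝ)) :=
    Real.log_nonneg (by nlinarith [Real.add_one_le_exp (1 : ℝ)])
  have h2 : 0 < Real.log (2 * (p : ℝ) * ((taylorDegree γ ε : ℝ) + 2) / δ) := by
    refine Real.log_pos ?_
    rw [lt_div_iff₀ hδ]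
    nlinarith [(Nat.cast_nonneg (taylorDegree γ ε) : (0 : ℝ) ≤ taylorDegree γ ε)]
  unfold numSamples
  exact Nat.ceil_pos.2 (by positivity)

end

end IsingScreening

/-! ### The main theorem: union bound over the moments and conclusion. -/

theorem theorem1 {p : ℕ} (θ : Params p) {γ ε δ : ℝ}
    (hwidth : WidthLE θ γ) (hε : 0 < ε) (hεγ : ε ≤ 4 * γ) (hδ : 0 < δ)
    {Ω : Type*} [MeasurableSpace Ω] (P : Measure Ω) [IsProbabilityMeasure P]
    (X : StatIndex p (momentOrder (taylorDegree γ ε)) →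
      Fin (numSamples p γ ε δ) → Ω → Config p)
    (hlaw : ∀ K i, HasLaw (X K i) (gibbsMeasure θ) P)
    (hindep : ∀ K, iIndepFun (X K) P) :
    1 - δ ≤ P.real {ω | ∀ u v : Fin p, v ≠ u →
        |estimate (taylorDegree γ ε) (fun K => empiricalMoment (fun i => X K i ω) K.1)
            γ (stepSize p γ ε) (numSteps p γ ε) u v - θ.coupling u v| ≤ ε} ∧
      (fun g : ℝ => (taylorDegree g ε : ℝ)) =O[Filter.atTop] (fun g : ℝ => g) := by
  refine ⟨?_, taylorDegree_isBigO hε⟩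
  have hγ : 0 < γ := by linarith
  rcases le_or_gt 1 δ with hδ1 | hδ1
  · exact (sub_nonpos.2 hδ1).trans measureReal_nonneg
  rcases Nat.eq_zero_or_pos p with rfl | hp
  · have huniv : {ω | ∀ u v : Fin 0, v ≠ u →
        |estimate (taylorDegree γ ε) (fun K => empiricalMoment (fun i => X K i ω) K.1)
            γ (stepSize 0 γ ε) (numSteps 0 γ ε) u v - θ.coupling u v| ≤ ε} = Set.univ :=
      Set.eq_univ_of_forall fun ω u => u.elim0
    rw [huniv, probReal_univ]
    linarith
  have hacc : 0 ≤ momentAccuracy γ ε := by unfold momentAccuracy; positivity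
  obtain ⟨hd1, hd2⟩ := taylorDegree_spec hε hεγ
  set good := {ω | ∀ u v : Fin p, v ≠ u →
        |estimate (taylorDegree γ ε) (fun K => empiricalMoment (fun i => X K i ω) K.1)
            γ (stepSize p γ ε) (numSteps p γ ε) u v - θ.coupling u v| ≤ ε} with hgood
  set bad := ⋃ K : StatIndex p (momentOrder (taylorDegree γ ε)),
    {ω | momentAccuracy γ ε ≤ |empiricalMoment (fun i => X K i ω) K.1 - gibbsMoment θ K.1|}
    with hbad
  -- Covering the space and using subadditivity avoids any measurability question about `good`.
  have hcover : good ∪ bad = Set.univ := by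
    refine Set.eq_univ_of_forall fun ω => ?_
    by_cases hω : ω ∈ bad
    · exact Or.inr hω
    · left
      simp only [hbad, Set.mem_iUnion, not_exists] at hω
      exact fun u v hvu => abs_estimate_sub_le hwidth hε hεγ hd1 hd2
        (fun K => abs_empiricalMoment_le _ _) (fun K => (not_le.1 (hω K)).le) hvu
  have hbad_le : P.real bad ≤ δ := by
    refine (measureReal_iUnion_fintype_le _).trans ?_
    refine (Finset.sum_le_card_nsmul _ _ _ fun K _ => measureReal_empiricalMoment_le
      (numSamples_pos hp hγ hε hδ hδ1) (hlaw K) (hindep K) K.1 hacc).trans ?_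
    rw [nsmul_eq_mul, Finset.card_univ]
    exact two_mul_card_mul_exp_le hp hγ hε hδ
  have h := measureReal_union_le (μ := P) good bad
  rw [hcover, probReal_univ] at h
  linarith
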